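/- Let $(\Omega,\mathcal M,\mathbb P)$ be a probability space, let $p\in[1,\infty]$ and let $\mathcal L^p=\mathcal L^p(\Omega,\mathcal M,\mathbb P)$ be the normed space of real random variables with finite $p$-norm, random variables that agree almost surely being identified. A functional $F:\mathcal L^p\to(-\infty,\infty]$ is called closed convex if it is convex and lower semicontinuous for the norm of $\mathcal L^p$. Such a functional is called - a subregular error measure if $F(0)=0$, $F(X)\ge 0$ for all $X$, and for every $X\neq 0$ there is $\lambda>0$ with $F(\lambda X)>0$; - a subregular regret measure if $F(0)=0$, $F(X)\ge\mathbb E[X]$ for all $X$, and for every $X\ne 0$ there is $\lambda>0$ with $F(\lambda X)>\mathbb E[\lambda X]$; - a subregular deviation measure if $F(C)=0$ for all constants $C$, $F(X)\ge 0$ for all $X$, and for every non-constant $X$ there is $\lambda>0$ with $F(\lambda X)>0$; - a subregular risk measure if $F(C)=C$ for all constants $C$, $F(X)\ge\mathbb E[X]$ for all $X$, and for every non-constant $X$ there is $\lambda>0$ with $F(\lambda X)>\mathbb E[\lambda X]$. It is called positively homogeneous if $F(\lambda X)=\lambda F(X)$ for all $X\in\mathcal L^p$ and all $\lambda\ge 0$,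 where $0\cdot\infty=0$. For $\tau>0$ put $$F_\tau(X)=\inf_{\lambda>0}\lambda\bigl[F(\lambda^{-1}X)+\tau\bigr],\qquad X\in\mathcal L^p.$$ Then for every $\tau>0$: if $F$ is a subregular error measure, a subregular regret measure, a subregular deviation measure, or a subregular risk measure, then $F_\tau$ is a positively homogeneous subregular error measure, regret measure, deviation measure, or risk measure, respectively. (In particular $F_\tau$ is again closed and convex and never takes the value $-\infty$.) -/

import Mathlib

open MeasureTheory
open scoped ENNReal

namespace RiskQuadrangle

/-- Closed (that is, lower semicontinuous for the norm of `L^p`) convex functionals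
`L^p → (-∞, ∞]`. Values are taken in `EReal`, where `0 * ⊤ = 0`. -/
structure IsClosedConvex {Ω : Type*} [MeasurableSpace Ω] {P : Measure Ω} {p : ℝ≥0∞}
    [Fact (1 ≤ p)] (F : Lp ℝ p P → EReal) : Prop where
  ne_bot : ∀ X, F X ≠ ⊥
  convex : ∀ (X Y : Lp ℝ p P) (a : ℝ), 0 ≤ a → a ≤ 1 →
    F (a • X + (1 - a) • Y) ≤ (a : EReal) * F X + ((1 - a : ℝ) : EReal) * F Y
  closed : LowerSemicontinuous F

/-- The expectation `E[X]`, as an extended real number. -/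
noncomputable def expect {Ω : Type*} [MeasurableSpace Ω] {P : Measure Ω} {p : ℝ≥0∞}
    (X : Lp ℝ p P) : EReal :=
  ((∫ ω, X ω ∂P : ℝ) : EReal)

/-- `X` is (almost surely) equal to a constant. -/
def IsConstant {Ω : Type*} [MeasurableSpace Ω] {P : Measure Ω} [IsProbabilityMeasure P]
    {p : ℝ≥0∞} (X : Lp ℝ p P) : Prop :=
  ∃ c : ℝ, X = Lp.const p P c

/-- Subregular measures of risk. -/
structure IsSubregularRisk {Ω : Type*} [MeasurableSpace Ω] {P : Measure Ω}
    [IsProbabilityMeasure P] {p : ℝ≥0∞} [Fact (1 ≤ p)] (R : Lp ℝ p P → EReal) : Prop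
    extends IsClosedConvex R where
  map_const : ∀ c : ℝ, R (Lp.const p P c) = (c : EReal)
  expect_le : ∀ X, expect X ≤ R X
  subaversity : ∀ X : Lp ℝ p P, ¬ IsConstant X →
    ∃ l : ℝ, 0 < l ∧ expect (l • X) < R (l • X)

/-- Subregular measures of deviation; `nonneg` says that the values lie in `[0, ∞]`. -/
structure IsSubregularDeviation {Ω : Type*} [MeasurableSpace Ω] {P : Measure Ω}
    [IsProbabilityMeasure P] {p : ℝ≥0∞} [Fact (1 ≤ p)] (D : Lp ℝ p P → EReal) : Prop
    extends IsClosedConvex D where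
  map_const : ∀ c : ℝ, D (Lp.const p P c) = 0
  nonneg : ∀ X, 0 ≤ D X
  subaversity : ∀ X : Lp ℝ p P, ¬ IsConstant X → ∃ l : ℝ, 0 < l ∧ 0 < D (l • X)

/-- Subregular measures of regret. -/
structure IsSubregularRegret {Ω : Type*} [MeasurableSpace Ω] {P : Measure Ω}
    [IsProbabilityMeasure P] {p : ℝ≥0∞} [Fact (1 ≤ p)] (V : Lp ℝ p P → EReal) : Prop
    extends IsClosedConvex V where
  map_zero : V 0 = 0
  expect_le : ∀ X, expect X ≤ V X
  subaversity : ∀ X : Lp ℝ p P, X ≠ 0 →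
    ∃ l : ℝ, 0 < l ∧ expect (l • X) < V (l • X)

/-- Subregular measures of error; `nonneg` says that the values lie in `[0, ∞]`. -/
structure IsSubregularError {Ω : Type*} [MeasurableSpace Ω] {P : Measure Ω}
    [IsProbabilityMeasure P] {p : ℝ≥0∞} [Fact (1 ≤ p)] (E : Lp ℝ p P → EReal) : Prop
    extends IsClosedConvex E where
  map_zero : E 0 = 0
  nonneg : ∀ X, 0 ≤ E X
  subaversity : ∀ X : Lp ℝ p P, X ≠ 0 → ∃ l : ℝ, 0 < l ∧ 0 < E (l • X)

/-- Positive homogeneity: `F (l X) = l F X` for all `l ≥ 0`, with `0 · ∞ = 0`. -/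
def IsPosHomogeneous {Ω : Type*} [MeasurableSpace Ω] {P : Measure Ω} {p : ℝ≥0∞}
    (F : Lp ℝ p P → EReal) : Prop :=
  ∀ (X : Lp ℝ p P) (l : ℝ), 0 ≤ l → F (l • X) = (l : EReal) * F X

/-- The family `F_τ(X) = inf_{l > 0} l (F(X / l) + τ)` obtained from the parent functional `F`
by the perspective transform. -/
noncomputable def perspectiveFamily {Ω : Type*} [MeasurableSpace Ω] {P : Measure Ω} {p : ℝ≥0∞}
    (F : Lp ℝ p P → EReal) (τ : ℝ) : Lp ℝ p P → EReal :=
  fun X => ⨅ (l : ℝ) (_ : 0 < l), (l : EReal) * (F (l⁻¹ • X) + (τ : EReal))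

end RiskQuadrangle

open Filter Topology

namespace RiskQuadrangle

section Perspective

variable {Ω : Type*} [MeasurableSpace Ω] {P : Measure Ω} {p : ℝ≥0∞} {F : Lp ℝ p P → EReal} {τ : ℝ}

/-! All four cases share one setting: `F 0 = 0` and `F` dominates a continuous linear `φ`, which is
`0` for error and deviation and the expectation for regret and risk. Rescaling `l` gives
homogeneity, and joint convexity of the perspective gives subadditivity. The bound `l * (F (l⁻¹ • X)
+ τ) ≥ φ X + l * τ` keeps `φ` as a minorant and, since `τ > 0`, bounds near-minimizing `l`. This
compactness yields closedness (`isClosed_perspectiveFamily_le`); the same bound gives strictness for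
large `l` (`lt_perspectiveFamily`). -/

lemma perspectiveFamily_le (F : Lp ℝ p P → EReal) (τ : ℝ) (X : Lp ℝ p P) {l : ℝ} (hl : 0 < l) :
    perspectiveFamily F τ X ≤ (l : EReal) * (F (l⁻¹ • X) + (τ : EReal)) :=
  iInf₂_le l hl

lemma perspectiveFamily_le_coe {X : Lp ℝ p P} {l r : ℝ} (hl : 0 < l)
    (h : F (l⁻¹ • X) ≤ (r : EReal)) :
    perspectiveFamily F τ X ≤ ((l * (r + τ) : ℝ) : EReal) := by
  refine (perspectiveFamily_le F τ X hl).trans ?_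
  rw [EReal.coe_mul, EReal.coe_add]
  exact mul_le_mul_of_nonneg_left (add_le_add_left h _) (EReal.coe_nonneg.2 hl.le)

/-- Reduces later estimates to real arithmetic: a product below a real number forces `F` to be
finite there. -/
lemma exists_of_perspectiveFamily_lt (hF : ∀ X, F X ≠ ⊥) {X : Lp ℝ p P} {a : ℝ}
    (h : perspectiveFamily F τ X < (a : EReal)) :
    ∃ l : ℝ, 0 < l ∧ ∃ r : ℝ, F (l⁻¹ • X) = (r : EReal) ∧ l * (r + τ) < a := by
  obtain ⟨l, hl, h⟩ : ∃ l : ℝ, 0 < l ∧ (l : EReal) * (F (l⁻¹ • X) + (τ : EReal)) < a := by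
    simpa [perspectiveFamily, iInf_lt_iff] using h
  refine ⟨l, hl, ?_⟩
  have hb := hF (l⁻¹ • X)
  generalize F (l⁻¹ • X) = y at h hb
  induction y using EReal.rec with
  | bot => exact absurd rfl hb
  | coe r => exact ⟨r, rfl, by exact_mod_cast h⟩
  | top => simp [EReal.coe_mul_top_of_pos hl] at h

lemma le_perspectiveFamily (hF : ∀ X, F X ≠ ⊥) {X : Lp ℝ p P} {a : ℝ}
    (h : ∀ l r : ℝ, 0 < l → F (l⁻¹ • X) = (r : EReal) → a ≤ l * (r + τ)) :
    (a : EReal) ≤ perspectiveFamily F τ X := by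
  by_contra! hlt
  obtain ⟨l, hl, r, hr, hlr⟩ := exists_of_perspectiveFamily_lt hF hlt
  exact absurd (h l r hl hr) (not_le.2 hlr)

lemma perspectiveFamily_smul_le (F : Lp ℝ p P → EReal) (τ : ℝ) (X : Lp ℝ p P) {t : ℝ}
    (ht : 0 < t) :
    perspectiveFamily F τ (t • X) ≤ (t : EReal) * perspectiveFamily F τ X := by
  have key : ((t⁻¹ : ℝ) : EReal) * perspectiveFamily F τ (t • X) ≤ perspectiveFamily F τ X := by
    refine le_iInf₂ fun l hl => ?_
    refine (mul_le_mul_of_nonneg_left (perspectiveFamily_le F τ (t • X) (mul_pos ht hl))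
      (EReal.coe_nonneg.2 (inv_pos.2 ht).le)).trans_eq ?_
    rw [← mul_assoc, ← EReal.coe_mul, smul_smul]
    congr 4 <;> field_simp
  calc perspectiveFamily F τ (t • X)
      = (t : EReal) * (((t⁻¹ : ℝ) : EReal) * perspectiveFamily F τ (t • X)) := by
        rw [← mul_assoc, ← EReal.coe_mul, mul_inv_cancel₀ ht.ne', EReal.coe_one, one_mul]
    _ ≤ _ := mul_le_mul_of_nonneg_left key (EReal.coe_nonneg.2 ht.le)

lemma perspectiveFamily_smul (F : Lp ℝ p P → EReal) (τ : ℝ) (X : Lp ℝ p P) {t : ℝ}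
    (ht : 0 < t) :
    perspectiveFamily F τ (t • X) = (t : EReal) * perspectiveFamily F τ X := by
  refine (perspectiveFamily_smul_le F τ X ht).antisymm ?_
  -- The reverse inequality is the first one at `t • X` with factor `t⁻¹`.
  have h := mul_le_mul_of_nonneg_left (perspectiveFamily_smul_le F τ (t • X) (inv_pos.2 ht))
    (EReal.coe_nonneg.2 ht.le)
  rwa [smul_smul, inv_mul_cancel₀ ht.ne', one_smul, ← mul_assoc, ← EReal.coe_mul,
    mul_inv_cancel₀ ht.ne', EReal.coe_one, one_mul] at h

/-! ### Convexity, linear minorants and closedness -/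

variable [Fact (1 ≤ p)] {φ : Lp ℝ p P →L[ℝ] ℝ}

lemma IsClosedConvex.map_smul_le_coe (hF : IsClosedConvex F) (h0 : F 0 = 0) {X : Lp ℝ p P}
    {r t : ℝ} (ht : 0 ≤ t) (ht1 : t ≤ 1) (hr : F X ≤ (r : EReal)) :
    F (t • X) ≤ ((t * r : ℝ) : EReal) := by
  have h := hF.convex X 0 t ht ht1
  rw [smul_zero, add_zero, h0, mul_zero, add_zero] at h
  rw [EReal.coe_mul]
  exact h.trans (mul_le_mul_of_nonneg_left hr (EReal.coe_nonneg.2 ht))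

lemma IsClosedConvex.perspectiveFamily_add_le_coe (hF : IsClosedConvex F) {X Y : Lp ℝ p P}
    {a b : ℝ} (ha : perspectiveFamily F τ X < (a : EReal))
    (hb : perspectiveFamily F τ Y < (b : EReal)) :
    perspectiveFamily F τ (X + Y) ≤ ((a + b : ℝ) : EReal) := by
  obtain ⟨l, hl, r, hr, hlr⟩ := exists_of_perspectiveFamily_lt hF.ne_bot ha
  obtain ⟨m, hm, s, hs, hms⟩ := exists_of_perspectiveFamily_lt hF.ne_bot hb
  have hlm : 0 < l + m := add_pos hl hm
  -- With this weight the convex combination is `(l + m)⁻¹ • (X + Y)`.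
  have h := hF.convex (l⁻¹ • X) (m⁻¹ • Y) (l / (l + m)) (by positivity)
    ((div_le_one hlm).2 (by linarith))
  have e : (l / (l + m)) • l⁻¹ • X + (1 - l / (l + m)) • m⁻¹ • Y = (l + m)⁻¹ • (X + Y) := by
    rw [smul_smul, smul_smul, smul_add]
    congr 2 <;> field_simp
    ring
  rw [e, hr, hs] at h
  refine (perspectiveFamily_le_coe hlm (by exact_mod_cast h)).trans (EReal.coe_le_coe_iff.2 ?_)
  have : (l + m) * (l / (l + m) * r + (1 - l / (l + m)) * s + τ)
      = l * (r + τ) + m * (s + τ) := by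
    field_simp
    ring
  linarith

/-- The perspective transform preserves a continuous linear minorant. -/
lemma coe_le_perspectiveFamily (hτ : 0 ≤ τ) (hF : ∀ X, F X ≠ ⊥)
    (hφ : ∀ X, (φ X : EReal) ≤ F X) (X : Lp ℝ p P) :
    (φ X : EReal) ≤ perspectiveFamily F τ X := by
  refine le_perspectiveFamily hF fun l r hl hr => ?_
  have h := hφ (l⁻¹ • X)
  rw [hr, EReal.coe_le_coe_iff, map_smul, smul_eq_mul, inv_mul_le_iff₀ hl] at h
  nlinarith [mul_nonneg hl.le hτ]

lemma perspectiveFamily_eq_coe (hτ : 0 ≤ τ) (hF : ∀ X, F X ≠ ⊥)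
    (hφ : ∀ X, (φ X : EReal) ≤ F X) {X : Lp ℝ p P}
    (hX : ∀ t : ℝ, F (t • X) = ((φ (t • X) : ℝ) : EReal)) :
    perspectiveFamily F τ X = (φ X : EReal) := by
  refine le_antisymm (EReal.le_of_forall_lt_iff_le.1 fun z hz => ?_)
    (coe_le_perspectiveFamily hτ hF hφ X)
  have hz' : 0 < z - φ X := sub_pos.2 (EReal.coe_lt_coe_iff.1 hz)
  -- The value at `l` is `φ X + l * τ`, so `l` must be small; `τ + 1` also covers `τ = 0`.
  have hl : 0 < (z - φ X) / (τ + 1) := by positivity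
  refine (perspectiveFamily_le_coe hl (hX _).le).trans (EReal.coe_le_coe_iff.2 ?_)
  rw [map_smul, smul_eq_mul, mul_add, mul_inv_cancel_left₀ hl.ne']
  have : (z - φ X) / (τ + 1) * τ ≤ z - φ X := by
    rw [div_mul_eq_mul_div, div_le_iff₀ (by positivity)]
    nlinarith
  linarith

lemma isPosHomogeneous_perspectiveFamily (hτ : 0 ≤ τ) (hF : ∀ X, F X ≠ ⊥)
    (hφ : ∀ X, (φ X : EReal) ≤ F X) (h0 : F 0 = 0) :
    IsPosHomogeneous (perspectiveFamily F τ) := by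
  intro X t ht
  rcases ht.eq_or_lt with rfl | ht
  · rw [zero_smul, perspectiveFamily_eq_coe hτ hF hφ (by simp [h0])]
    simp
  · exact perspectiveFamily_smul F τ X ht

lemma isClosed_perspectiveFamily_le (hτ : 0 < τ) (hF : IsClosedConvex F)
    (hφ : ∀ X, (φ X : EReal) ≤ F X) (h0 : F 0 = 0) (α : ℝ) :
    IsClosed {X | perspectiveFamily F τ X ≤ (α : EReal)} := by
  refine IsSeqClosed.isClosed fun u X hu hX => ?_
  have hex (n : ℕ) : ∃ l : ℝ, 0 < l ∧ ∃ r : ℝ,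
      F (l⁻¹ • u n) = (r : EReal) ∧ l * (r + τ) < α + 1 / ((n : ℝ) + 1) :=
    exists_of_perspectiveFamily_lt hF.ne_bot
      ((hu n).trans_lt (EReal.coe_lt_coe_iff.2 (lt_add_of_pos_right _ (by positivity))))
  choose l hl r hr hlr using hex
  have hε : Tendsto (fun n : ℕ => α + 1 / ((n : ℝ) + 1)) atTop (𝓝 α) := by
    simpa using tendsto_const_nhds.add (tendsto_one_div_add_atTop_nhds_zero_nat (𝕜 := ℝ))
  have hφu : Tendsto (fun n => φ (u n)) atTop (𝓝 (φ X)) := (φ.continuous.tendsto X).comp hX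
  have hlb (n : ℕ) : l n ≤ (α + 1 / ((n : ℝ) + 1) - φ (u n)) / τ := by
    have h := hφ ((l n)⁻¹ • u n)
    rw [hr, EReal.coe_le_coe_iff, map_smul, smul_eq_mul, inv_mul_le_iff₀ (hl n)] at h
    rw [le_div_iff₀ hτ]
    linarith [hlr n, mul_add (l n) (r n) τ]
  obtain ⟨M, hM⟩ := ((hε.sub hφu).div_const τ).bddAbove_range
  -- If the limit `c` is positive, it serves as scale for `X`; if `c = 0`, convexity through the
  -- origin controls `F` along the whole ray of `X`.
  obtain ⟨c, ⟨hc0, -⟩, f, hf, hfc⟩ := isCompact_Icc.tendsto_subseq (x := l) (s := Set.Icc 0 M)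
    fun n => ⟨(hl n).le, (hlb n).trans (hM ⟨n, rfl⟩)⟩
  have hεf := hε.comp hf.tendsto_atTop
  have huf := hX.comp hf.tendsto_atTop
  rcases hc0.eq_or_lt with rfl | hc
  · -- the recession case
    have hrec {t : ℝ} (ht : 0 < t) : F (t • X) ≤ ((t * α : ℝ) : EReal) := by
      refine EReal.le_of_forall_lt_iff_le.1 fun z hz => ?_
      refine (hF.closed.isClosed_preimage z).mem_of_tendsto (huf.const_smul t) ?_
      have h1 : ∀ᶠ n in atTop, t * (α + 1 / ((f n : ℝ) + 1)) < z :=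
        (hεf.const_mul t).eventually_lt_const (EReal.coe_lt_coe_iff.1 hz)
      have h2 : ∀ᶠ n in atTop, t * l (f n) < 1 :=
        (hfc.const_mul t).eventually_lt_const (by simp)
      filter_upwards [h1, h2] with n h1 h2
      have h := hF.map_smul_le_coe h0 (mul_pos ht (hl (f n))).le h2.le (hr (f n)).le
      rw [smul_smul, mul_inv_cancel_right₀ (hl (f n)).ne'] at h
      refine h.trans (EReal.coe_le_coe_iff.2 ?_)
      have := mul_lt_mul_of_pos_left (hlr (f n)) ht
      nlinarith [mul_pos (mul_pos ht (hl (f n))) hτ]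
    refine EReal.le_of_forall_lt_iff_le.1 fun z hz => ?_
    have hz' : 0 < z - α := sub_pos.2 (EReal.coe_lt_coe_iff.1 hz)
    -- On the ray the value at scale `m` is at most `α + m * τ`, which equals `z` here.
    have hm : 0 < (z - α) / τ := by positivity
    refine (perspectiveFamily_le_coe hm (hrec (inv_pos.2 hm))).trans (EReal.coe_le_coe_iff.2 ?_)
    rw [mul_add, mul_inv_cancel_left₀ hm.ne', div_mul_cancel₀ _ hτ.ne']
    linarith
  · have hFc : F (c⁻¹ • X) ≤ ((α / c - τ : ℝ) : EReal) := by
      refine EReal.le_of_forall_lt_iff_le.1 fun z hz => ?_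
      have hinv : Tendsto (fun n => (l (f n))⁻¹) atTop (𝓝 c⁻¹) := hfc.inv₀ hc.ne'
      refine (hF.closed.isClosed_preimage z).mem_of_tendsto (hinv.smul huf) ?_
      have h1 : ∀ᶠ n in atTop, (α + 1 / ((f n : ℝ) + 1)) / l (f n) - τ < z :=
        ((hεf.div hfc hc.ne').sub_const τ).eventually_lt_const (EReal.coe_lt_coe_iff.1 hz)
      filter_upwards [h1] with n h1
      change F ((l (f n))⁻¹ • u (f n)) ≤ (z : EReal)
      rw [hr, EReal.coe_le_coe_iff]
      have := (lt_div_iff₀' (hl (f n))).2 (hlr (f n))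
      linarith
    refine (perspectiveFamily_le_coe hc hFc).trans_eq ?_
    rw [sub_add_cancel, mul_div_cancel₀ _ hc.ne']

lemma IsClosedConvex.perspectiveFamily (hτ : 0 < τ) (hF : IsClosedConvex F)
    (hφ : ∀ X, (φ X : EReal) ≤ F X) (h0 : F 0 = 0) :
    IsClosedConvex (perspectiveFamily F τ) where
  ne_bot X := ((EReal.bot_lt_coe _).trans_le
    (coe_le_perspectiveFamily hτ.le hF.ne_bot hφ X)).ne'
  convex X Y a ha ha1 := by
    have hhom := isPosHomogeneous_perspectiveFamily hτ.le hF.ne_bot hφ h0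
    have hnb (Z) : RiskQuadrangle.perspectiveFamily F τ Z ≠ ⊥ := ((EReal.bot_lt_coe _).trans_le
      (coe_le_perspectiveFamily hτ.le hF.ne_bot hφ Z)).ne'
    rw [← hhom X a ha, ← hhom Y (1 - a) (sub_nonneg.2 ha1)]
    refine EReal.le_add_of_forall_gt (.inl (hnb _)) (.inr (hnb _)) fun x hx y hy => ?_
    obtain ⟨x', hx1, hx2⟩ := EReal.lt_iff_exists_real_btwn.1 hx
    obtain ⟨y', hy1, hy2⟩ := EReal.lt_iff_exists_real_btwn.1 hy
    refine (hF.perspectiveFamily_add_le_coe hx1 hy1).trans ?_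
    rw [EReal.coe_add]
    exact add_le_add hx2.le hy2.le
  closed := by
    refine lowerSemicontinuous_iff_isClosed_preimage.2 fun y => ?_
    induction y using EReal.rec with
    | bot =>
      convert isClosed_empty
      refine Set.eq_empty_of_forall_notMem fun X hX => ?_
      exact absurd ((coe_le_perspectiveFamily hτ.le hF.ne_bot hφ X).trans hX)
        (not_le.2 (EReal.bot_lt_coe _))
    | coe α => exact isClosed_perspectiveFamily_le hτ hF hφ h0 α
    | top => simp

lemma lt_perspectiveFamily (hτ : 0 < τ) (hF : IsClosedConvex F)
    (hφ : ∀ X, (φ X : EReal) ≤ F X) (h0 : F 0 = 0) {X : Lp ℝ p P} {t : ℝ} (ht : 0 < t)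
    (h : ((φ (t • X) : ℝ) : EReal) < F (t • X)) :
    (φ X : EReal) < perspectiveFamily F τ X := by
  obtain ⟨z, hz1, hz2⟩ := EReal.lt_iff_exists_real_btwn.1 h
  rw [EReal.coe_lt_coe_iff, map_smul, smul_eq_mul, ← lt_div_iff₀' ht] at hz1
  -- For `l ≤ 1 / t`, convexity through the origin bounds the value below by `z / t`; for `l ≥ 1 /
  -- t`, the term `l * τ` adds at least `τ / t` to `φ X`.
  have hmin : φ X < min (z / t) (φ X + τ / t) := lt_min hz1 (by simpa using div_pos hτ ht)
  refine (EReal.coe_lt_coe_iff.2 hmin).trans_le (le_perspectiveFamily hF.ne_bot fun l r hl hr => ?_)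
  rcases le_total (t * l) 1 with hle | hle
  · refine (min_le_left _ _).trans ((div_le_iff₀' ht).2 ?_)
    have h1 := hF.map_smul_le_coe h0 (mul_pos ht hl).le hle hr.le
    rw [smul_smul, mul_inv_cancel_right₀ hl.ne'] at h1
    have h2 := EReal.coe_lt_coe_iff.1 (hz2.trans_le h1)
    nlinarith [mul_pos (mul_pos ht hl) hτ]
  · refine (min_le_right _ _).trans ?_
    have h1 := hφ (l⁻¹ • X)
    rw [hr, EReal.coe_le_coe_iff, map_smul, smul_eq_mul, inv_mul_le_iff₀ hl] at h1
    have h2 : τ / t ≤ l * τ := (div_le_iff₀ ht).2 (by nlinarith)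
    linarith [mul_add l r τ]

end Perspective

lemma smul_Lp_const {Ω : Type*} [MeasurableSpace Ω] {P : Measure Ω} [IsFiniteMeasure P]
    {p : ℝ≥0∞} (t c : ℝ) : t • Lp.const p P c = Lp.const p P (t * c) :=
  ((Lp.constₗ p P ℝ).map_smul t c).symm

section Expectation

variable {Ω : Type*} [MeasurableSpace Ω] (P : Measure Ω) [IsProbabilityMeasure P]
  (p : ℝ≥0∞) [hp : Fact (1 ≤ p)]

/-- The expectation as a continuous linear functional on `L^p`. -/
noncomputable def expectCLM : Lp ℝ p P →L[ℝ] ℝ :=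
  LinearMap.mkContinuous
    { toFun := fun X => ∫ ω, X ω ∂P
      map_add' := fun X Y => by
        rw [integral_congr_ae (Lp.coeFn_add X Y)]
        exact integral_add ((Lp.memLp X).integrable hp.out) ((Lp.memLp Y).integrable hp.out)
      map_smul' := fun c X => by
        rw [integral_congr_ae (Lp.coeFn_smul c X)]
        exact integral_smul c X }
    1 fun X => by
      rw [one_mul, Lp.norm_def]
      refine (norm_integral_le_integral_norm _).trans ?_
      rw [integral_norm_eq_lintegral_enorm (Lp.aestronglyMeasurable X),
        ← eLpNorm_one_eq_lintegral_enorm]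
      -- On a probability space the `L^1` norm is at most the `L^p` norm.
      exact ENNReal.toReal_mono (Lp.eLpNorm_ne_top X)
        (eLpNorm_le_eLpNorm_of_exponent_le hp.out (Lp.aestronglyMeasurable X))

variable {P p}

lemma expectCLM_const (c : ℝ) : expectCLM P p (Lp.const p P c) = c := by
  change ∫ ω, Lp.const p P c ω ∂P = c
  rw [integral_congr_ae (Lp.coeFn_const p P c)]
  simp

end Expectation

end RiskQuadrangle

theorem mainTheorem8 {Ω : Type*} [MeasurableSpace Ω] (P : Measure Ω) [IsProbabilityMeasure P]
    (p : ℝ≥0∞) [Fact (1 ≤ p)] (F : Lp ℝ p P → EReal) (τ : ℝ) (hτ : 0 < τ) :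
    (RiskQuadrangle.IsSubregularError F →
      RiskQuadrangle.IsPosHomogeneous (RiskQuadrangle.perspectiveFamily F τ) ∧
      RiskQuadrangle.IsSubregularError (RiskQuadrangle.perspectiveFamily F τ)) ∧
    (RiskQuadrangle.IsSubregularRegret F →
      RiskQuadrangle.IsPosHomogeneous (RiskQuadrangle.perspectiveFamily F τ) ∧
      RiskQuadrangle.IsSubregularRegret (RiskQuadrangle.perspectiveFamily F τ)) ∧
    (RiskQuadrangle.IsSubregularDeviation F →
      RiskQuadrangle.IsPosHomogeneous (RiskQuadrangle.perspectiveFamily F τ) ∧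
      RiskQuadrangle.IsSubregularDeviation (RiskQuadrangle.perspectiveFamily F τ)) ∧
    (RiskQuadrangle.IsSubregularRisk F →
      RiskQuadrangle.IsPosHomogeneous (RiskQuadrangle.perspectiveFamily F τ) ∧
      RiskQuadrangle.IsSubregularRisk (RiskQuadrangle.perspectiveFamily F τ)) := by
  open RiskQuadrangle in
  refine ⟨fun h => ?_, fun h => ?_, fun h => ?_, fun h => ?_⟩
  · have hφ : ∀ X, (((0 : Lp ℝ p P →L[ℝ] ℝ) X : ℝ) : EReal) ≤ F X := by simpa using h.nonneg
    have hcc := h.toIsClosedConvex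
    -- The multiplier `1` suffices: the transform is already strict at `X` itself.
    refine ⟨isPosHomogeneous_perspectiveFamily hτ.le hcc.ne_bot hφ h.map_zero,
      hcc.perspectiveFamily hτ hφ h.map_zero, ?_, fun X => ?_, fun X hX => ⟨1, one_pos, ?_⟩⟩
    · simpa using perspectiveFamily_eq_coe hτ.le hcc.ne_bot hφ (X := 0) (by simp [h.map_zero])
    · simpa using coe_le_perspectiveFamily hτ.le hcc.ne_bot hφ X
    · obtain ⟨t, ht, hlt⟩ := h.subaversity X hX
      simpa using lt_perspectiveFamily hτ hcc hφ h.map_zero ht (by simpa using hlt)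
  · have hφ : ∀ X, ((expectCLM P p X : ℝ) : EReal) ≤ F X := h.expect_le
    have hcc := h.toIsClosedConvex
    refine ⟨isPosHomogeneous_perspectiveFamily hτ.le hcc.ne_bot hφ h.map_zero,
      hcc.perspectiveFamily hτ hφ h.map_zero, ?_, fun X => ?_, fun X hX => ⟨1, one_pos, ?_⟩⟩
    · simpa using perspectiveFamily_eq_coe hτ.le hcc.ne_bot hφ (X := 0) (by simp [h.map_zero])
    · exact coe_le_perspectiveFamily hτ.le hcc.ne_bot hφ X
    · obtain ⟨t, ht, hlt⟩ := h.subaversity X hX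
      rw [one_smul]
      exact lt_perspectiveFamily hτ hcc hφ h.map_zero ht hlt
  · have hφ : ∀ X, (((0 : Lp ℝ p P →L[ℝ] ℝ) X : ℝ) : EReal) ≤ F X := by simpa using h.nonneg
    have hcc := h.toIsClosedConvex
    have h0 : F 0 = 0 := by simpa using h.map_const 0
    refine ⟨isPosHomogeneous_perspectiveFamily hτ.le hcc.ne_bot hφ h0,
      hcc.perspectiveFamily hτ hφ h0, fun c => ?_, fun X => ?_, fun X hX => ⟨1, one_pos, ?_⟩⟩
    · simpa using perspectiveFamily_eq_coe hτ.le hcc.ne_bot hφ (X := Lp.const p P c)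
        (by simp [smul_Lp_const, h.map_const])
    · simpa using coe_le_perspectiveFamily hτ.le hcc.ne_bot hφ X
    · obtain ⟨t, ht, hlt⟩ := h.subaversity X hX
      simpa using lt_perspectiveFamily hτ hcc hφ h0 ht (by simpa using hlt)
  · have hφ : ∀ X, ((expectCLM P p X : ℝ) : EReal) ≤ F X := h.expect_le
    have hcc := h.toIsClosedConvex
    have h0 : F 0 = 0 := by simpa using h.map_const 0
    refine ⟨isPosHomogeneous_perspectiveFamily hτ.le hcc.ne_bot hφ h0,
      hcc.perspectiveFamily hτ hφ h0, fun c => ?_, fun X => ?_, fun X hX => ⟨1, one_pos, ?_⟩⟩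
    · rw [perspectiveFamily_eq_coe hτ.le hcc.ne_bot hφ fun t => ?_, expectCLM_const]
      rw [smul_Lp_const, h.map_const, expectCLM_const]
    · exact coe_le_perspectiveFamily hτ.le hcc.ne_bot hφ X
    · obtain ⟨t, ht, hlt⟩ := h.subaversity X hX
      rw [one_smul]
      exact lt_perspectiveFamily hτ hcc hφ h0 ht hlt
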